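/- On $\mathbb{C}^3\otimes\mathbb{C}^3$ with computational basis $|0\rangle,|1\rangle,|2\rangle$ on each side, write $|i\pm j\rangle=\tfrac{1}{\sqrt2}(|i\rangle\pm|j\rangle)$ and consider the nine orthonormal product vectors $$|\psi_0\rangle=|1\rangle\otimes|1\rangle,\quad |\psi_{1\pm}\rangle=|0\rangle\otimes|0\pm1\rangle,\quad |\psi_{2\pm}\rangle=|0\pm1\rangle\otimes|2\rangle,\quad |\psi_{3\pm}\rangle=|1\pm2\rangle\otimes|0\rangle,\quad |\psi_{4\pm}\rangle=|2\rangle\otimes|1\pm2\rangle,$$ and the states $$\sigma=\frac14\sum_{i=1}^4|\psi_{i+}\rangle\langle\psi_{i+}|,\qquad \rho=\frac15\Big(|\psi_0\rangle\langle\psi_0|+\sum_{i=1}^4|\psi_{i-}\rangle\langle\psi_{i-}|\Big).$$ Let SEP be the set of two-outcome POVMs $(\Pi_R,\Pi_S)$ both of whose elements are separable, i.e. positive combinations of product projectors $|\phi\rangle\langle\phi|\otimes|\chi\rangle\langle\chi|$. Let LOCC be the set of two-outcome POVMs implemented by finite-round, finite-outcome protocols in which Alice and Bob adaptively perform local measurements,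 communicate the outcomes classically, and finally announce one of two guesses. Let $\overline{\mathrm{LOCC}}$ be its closure (asymptotic LOCC). A POVM $(\Pi_R,\Pi_S)$ perfectly distinguishes $\rho$ and $\sigma$ if $\mathrm{tr}(\Pi_R\rho)=\mathrm{tr}(\Pi_S\sigma)=1$. For a set $\Omega$ of two-outcome POVMs and a hermitian $M=R-S$ with $R,S\ge0$ orthogonal, put $$\|M\|_\Omega=\sup_{(\Pi_R,\Pi_S)\in\Omega}\big[\mathrm{tr}(\Pi_RR)+\mathrm{tr}(\Pi_SS)\big],\qquad \|M\|'_\Omega=\sup_{(\Pi_R,\Pi_S)\in\Omega}\mathrm{tr}\big[(\Pi_R-\Pi_S)M\big].$$ Then: 1. some POVM in SEP perfectly distinguishes $\rho$ and $\sigma$; 2. no POVM in $\overline{\mathrm{LOCC}}$ perfectly distinguishes $\rho$ and $\sigma$; 3. $\|\rho-\sigma\|_{\mathrm{SEP}}>\|\rho-\sigma\|_{\mathrm{LOCC}}$, and also $\|\rho-\sigma\|'_{\mathrm{SEP}}>\|\rho-\sigma\|'_{\mathrm{LOCC}}$. -/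

import Mathlib

open scoped Matrix Kronecker ComplexOrder

noncomputable section

/-- Operators on the bipartite space `ℂ^m ⊗ ℂ^n`. -/
abbrev BipOp (m n : ℕ) : Type := Matrix (Fin m × Fin n) (Fin m × Fin n) ℂ

/-- The rank-one operator `|φ⟩⟨φ|`. -/
def ketbra {ι : Type} (φ : ι → ℂ) : Matrix ι ι ℂ := Matrix.vecMulVec φ (star φ)

/-- The product vector `|φ⟩ ⊗ |χ⟩`. -/
def ketTensor {m n : ℕ} (φ : Fin m → ℂ) (χ : Fin n → ℂ) : Fin m × Fin n → ℂ :=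
  fun p => φ p.1 * χ p.2

/-! ### Two-outcome measurements -/

/-- An ordered pair `(Π_R, Π_S)` is a two-outcome POVM. -/
def IsPOVM {m n : ℕ} (π : BipOp m n × BipOp m n) : Prop :=
  π.1.PosSemidef ∧ π.2.PosSemidef ∧ π.1 + π.2 = 1

/-- A separable operator: a positive combination of product projectors
`|φ⟩⟨φ| ⊗ |χ⟩⟨χ|` with `φ`, `χ` unit vectors (the empty combination is `0`). -/
def IsSeparableOp {m n : ℕ} (T : BipOp m n) : Prop :=
  ∃ (k : ℕ) (c : Fin k → ℝ) (φ : Fin k → Fin m → ℂ) (χ : Fin k → Fin n → ℂ),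
    (∀ j, 0 < c j) ∧ (∀ j, star (φ j) ⬝ᵥ φ j = 1) ∧ (∀ j, star (χ j) ⬝ᵥ χ j = 1) ∧
    T = ∑ j, (c j : ℂ) • (ketbra (φ j) ⊗ₖ ketbra (χ j))

/-- `SEP`: the two-outcome POVMs both of whose elements are separable. -/
def SEP (m n : ℕ) : Set (BipOp m n × BipOp m n) :=
  {π | IsPOVM π ∧ IsSeparableOp π.1 ∧ IsSeparableOp π.2}

/-- A finite-round, finite-outcome LOCC protocol with a binary final guess, on a bipartite system
whose current local dimensions are `m` (Alice) and `n` (Bob). It is a finite tree. At a leaf the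
parties announce a guess. At an inner node one party performs a local measurement with Kraus
operators `K i`, `∑ i, (K i)ᴴ * K i = 1`, and broadcasts the outcome `i`, on which the rest of the
protocol depends. A Kraus operator may change the dimension of the party's system, so local
ancillas are covered. -/
inductive LOCCProtocol : ℕ → ℕ → Type
  | guess {m n : ℕ} (g : Bool) : LOCCProtocol m n
  | alice {m n : ℕ} (k : ℕ) (d : Fin k → ℕ) (K : (i : Fin k) → Matrix (Fin (d i)) (Fin m) ℂ)
      (hK : ∑ i, (K i)ᴴ * K i = 1) (next : (i : Fin k) → LOCCProtocol (d i) n) :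
      LOCCProtocol m n
  | bob {m n : ℕ} (k : ℕ) (d : Fin k → ℕ) (K : (i : Fin k) → Matrix (Fin (d i)) (Fin n) ℂ)
      (hK : ∑ i, (K i)ᴴ * K i = 1) (next : (i : Fin k) → LOCCProtocol m (d i)) :
      LOCCProtocol m n

/-- The POVM element, on the system at the root, of the event that the protocol ends with the
guess `b`. -/
def LOCCProtocol.effect (b : Bool) : {m n : ℕ} → LOCCProtocol m n → BipOp m n
  | _, _, .guess g => if g = b then 1 else 0
  | _, n, .alice _ _ K _ next =>
      ∑ i, (K i ⊗ₖ (1 : Matrix (Fin n) (Fin n) ℂ))ᴴ * (next i).effect b *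
        (K i ⊗ₖ (1 : Matrix (Fin n) (Fin n) ℂ))
  | m, _, .bob _ _ K _ next =>
      ∑ i, ((1 : Matrix (Fin m) (Fin m) ℂ) ⊗ₖ K i)ᴴ * (next i).effect b *
        ((1 : Matrix (Fin m) (Fin m) ℂ) ⊗ₖ K i)

/-- `LOCC`: the two-outcome POVMs implemented by LOCC protocols (`true` is the first outcome). -/
def LOCC (m n : ℕ) : Set (BipOp m n × BipOp m n) :=
  {π | ∃ P : LOCCProtocol m n, π = (P.effect true, P.effect false)}

/-- `π` perfectly distinguishes the states `ρ` (first outcome) and `σ` (second outcome). -/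
def PerfectlyDistinguishes {m n : ℕ} (π : BipOp m n × BipOp m n) (ρ σ : BipOp m n) : Prop :=
  (π.1 * ρ).trace = 1 ∧ (π.2 * σ).trace = 1

/-! ### Distinguishability norms -/

/-- `‖M‖_Ω = sup_{π ∈ Ω} [tr(Π_R R) + tr(Π_S S)]`, where `M = R - S` is the (unique) decomposition
of the hermitian operator `M` into orthogonal non-negative operators. -/
def distNorm {m n : ℕ} (Ω : Set (BipOp m n × BipOp m n)) (M : BipOp m n) : ℝ :=
  sSup {v : ℝ | ∃ R S : BipOp m n, R.PosSemidef ∧ S.PosSemidef ∧ R * S = 0 ∧ M = R - S ∧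
    ∃ π ∈ Ω, v = ((π.1 * R).trace + (π.2 * S).trace).re}

/-- `sup_{π ∈ Ω} tr[(Π_R - Π_S) M]`, the normalization for which `(1 - ‖p ρ - q σ‖) / 2` is the
infimum error probability of distinguishing `ρ` from `σ` with prior probabilities `p`, `q`. -/
def distBiasNorm {m n : ℕ} (Ω : Set (BipOp m n × BipOp m n)) (M : BipOp m n) : ℝ :=
  sSup {v : ℝ | ∃ π ∈ Ω, v = ((π.1 - π.2) * M).trace.re}

/-! ### The two states -/

/-- The computational basis vector `|i⟩` of `ℂ^3`. -/
def ket (i : Fin 3) : Fin 3 → ℂ := Pi.single i 1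

/-- `(|i⟩ + s |j⟩) / √2`, that is `|i ± j⟩` for `s = ±1`. -/
def ketPM (s : ℂ) (i j : Fin 3) : Fin 3 → ℂ := ((Real.sqrt 2 : ℝ) : ℂ)⁻¹ • (ket i + s • ket j)

/-- `|ψ_0⟩ = |1⟩ ⊗ |1⟩`. -/
def psiZero : Fin 3 × Fin 3 → ℂ := ketTensor (ket 1) (ket 1)

/-- The four vectors `|ψ_{1±}⟩, …, |ψ_{4±}⟩` (in this order) for `s = ±1`. -/
def psi (s : ℂ) : Fin 4 → (Fin 3 × Fin 3 → ℂ) :=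
  ![ketTensor (ket 0) (ketPM s 0 1), ketTensor (ketPM s 0 1) (ket 2),
    ketTensor (ketPM s 1 2) (ket 0), ketTensor (ket 2) (ketPM s 1 2)]

def sigmaState : BipOp 3 3 := (1 / 4 : ℂ) • ∑ i, ketbra (psi 1 i)

def rhoState : BipOp 3 3 := (1 / 5 : ℂ) • (ketbra psiZero + ∑ i, ketbra (psi (-1) i))

end

/-! ### Quadratic forms -/

/-! The nine vectors form an orthonormal product basis, so the projectors `rhoProj` and `sigmaProj`
onto the two supports are separable, sum to `1` and discriminate perfectly. The real content is a
uniform lower bound on the LOCC error (`cost_effect_ge`); being a closed condition, it passes to the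
closure, and it separates both suprema.

At a node of a protocol the accumulated Kraus operators give a product `A ⊗ₖ B`, equal to `1 ⊗ₖ 1`
at the root, and the rest of the protocol splits it as `F + F'`. If the error is small relative to
the trace, Cauchy–Schwarz makes the form of `A ⊗ₖ B` small between basis vectors from the two
supports (`norm_form_le_of_cost_lt`). These forms factor, and when `A` and `B` are near multiples of
the identity, the tile structure of the basis forces both to be much nearer still
(`deviation_le_of_norm_le`). Hence no low-error splitting exists when a factor lies exactly on the
boundary of the neighbourhood (`gap_of_boundary`).

A measurement outcome may jump across that boundary, but error and trace are linear: interpolating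
between the splittings of parent and child gives a splitting on the boundary, so if the parent errs
too little, the child errs enough (`cost_ge_of_leave_left`, `cost_ge_of_leave_right`). A guess made
inside the neighbourhood is wrong with non-negligible weight. Induction over the tree
(`cost_pulledEffect_ge`) combines these cases. -/

lemma trace_mul_ketbra {ι : Type} [Fintype ι] (F : Matrix ι ι ℂ) (x : ι → ℂ) :
    (F * ketbra x).trace = star x ⬝ᵥ F *ᵥ x := by
  rw [ketbra, Matrix.mul_vecMulVec, Matrix.trace_vecMulVec, dotProduct_comm]

lemma posSemidef_ketbra {ι : Type} [Fintype ι] (x : ι → ℂ) : (ketbra x).PosSemidef :=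
  Matrix.posSemidef_vecMulVec_self_star x

open scoped MatrixOrder in
lemma exists_eq_conjTranspose_mul_self {ι : Type} [Fintype ι] [DecidableEq ι]
    {F : Matrix ι ι ℂ} (hF : F.PosSemidef) : ∃ C : Matrix ι ι ℂ, F = Cᴴ * C :=
  CStarAlgebra.nonneg_iff_eq_star_mul_self.mp hF.nonneg

lemma re_trace_mul_nonneg {ι : Type} [Fintype ι] [DecidableEq ι] {F G : Matrix ι ι ℂ}
    (hF : F.PosSemidef) (hG : G.PosSemidef) : 0 ≤ (F * G).trace.re := by
  obtain ⟨C, rfl⟩ := exists_eq_conjTranspose_mul_self hG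
  rw [← Matrix.mul_assoc, Matrix.trace_mul_comm, ← Matrix.mul_assoc]
  exact (Complex.le_def.mp (hF.mul_mul_conjTranspose_same C).trace_nonneg).1

/-- Cauchy–Schwarz for a positive semidefinite form, combined with the AM-GM inequality. -/
lemma norm_form_le {ι : Type} [Fintype ι] [DecidableEq ι] {F : Matrix ι ι ℂ}
    (hF : F.PosSemidef) {κ : ℝ} (hκ : 0 < κ) (x y : ι → ℂ) :
    ‖star x ⬝ᵥ F *ᵥ y‖ ≤
      (κ * (star x ⬝ᵥ F *ᵥ x).re + κ⁻¹ * (star y ⬝ᵥ F *ᵥ y).re) / 2 := by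
  obtain ⟨C, rfl⟩ := exists_eq_conjTranspose_mul_self hF
  have key : ∀ u v : ι → ℂ, star u ⬝ᵥ (Cᴴ * C) *ᵥ v = ∑ i, star ((C *ᵥ u) i) * (C *ᵥ v) i := by
    intro u v
    rw [← Matrix.mulVec_mulVec, Matrix.dotProduct_mulVec, ← Matrix.star_mulVec]
    rfl
  simp only [key]
  have sq : ∀ z : ℂ, (star z * z).re = ‖z‖ ^ 2 := by
    intro z
    rw [Complex.star_def, Complex.conj_mul']; norm_cast
  rw [Complex.re_sum, Complex.re_sum]
  simp only [sq]
  rw [Finset.mul_sum, Finset.mul_sum, ← Finset.sum_add_distrib, Finset.sum_div]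
  refine (norm_sum_le _ _).trans (Finset.sum_le_sum fun i _ => ?_)
  rw [norm_mul, norm_star]
  set a := ‖(C *ᵥ x) i‖
  set b := ‖(C *ᵥ y) i‖
  -- After writing `F = Cᴴ * C`, the bound is weighted AM-GM in each coordinate.
  have h : κ * a ^ 2 + κ⁻¹ * b ^ 2 - 2 * (a * b) = κ⁻¹ * (κ * a - b) ^ 2 := by
    field_simp
    ring
  have : 0 ≤ κ⁻¹ * (κ * a - b) ^ 2 := by positivity
  linarith

/-! ### The nine product vectors -/

lemma ketbra_ketTensor {m n : ℕ} (φ : Fin m → ℂ) (χ : Fin n → ℂ) :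
    ketbra (ketTensor φ χ) = ketbra φ ⊗ₖ ketbra χ := by
  ext p q
  simp [ketbra, ketTensor, Matrix.vecMulVec_apply, Matrix.kroneckerMap_apply]
  ring

lemma ketTensor_form {m n : ℕ} (A : Matrix (Fin m) (Fin m) ℂ) (B : Matrix (Fin n) (Fin n) ℂ)
    (φ φ' : Fin m → ℂ) (χ χ' : Fin n → ℂ) :
    star (ketTensor φ χ) ⬝ᵥ (A ⊗ₖ B) *ᵥ ketTensor φ' χ' =
      (star φ ⬝ᵥ A *ᵥ φ') * (star χ ⬝ᵥ B *ᵥ χ') := by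
  have dot : ∀ (u u' : Fin m → ℂ) (v v' : Fin n → ℂ),
      star (ketTensor u v) ⬝ᵥ ketTensor u' v' = (star u ⬝ᵥ u') * (star v ⬝ᵥ v') := by
    intro u u' v v'
    simp only [dotProduct, ketTensor, Pi.star_apply, Fintype.sum_prod_type, Finset.sum_mul_sum,
      star_mul']
    exact Finset.sum_congr rfl fun i _ => Finset.sum_congr rfl fun j _ => by ring
  have mul : (A ⊗ₖ B) *ᵥ ketTensor φ' χ' = ketTensor (A *ᵥ φ') (B *ᵥ χ') := by
    ext p
    simp only [Matrix.mulVec, dotProduct, ketTensor, Matrix.kroneckerMap_apply,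
      Fintype.sum_prod_type, Finset.sum_mul_sum]
    exact Finset.sum_congr rfl fun i _ => Finset.sum_congr rfl fun j _ => by ring
  rw [mul, dot]

lemma ketTensor_dot {m n : ℕ} (φ φ' : Fin m → ℂ) (χ χ' : Fin n → ℂ) :
    star (ketTensor φ χ) ⬝ᵥ ketTensor φ' χ' = (star φ ⬝ᵥ φ') * (star χ ⬝ᵥ χ') := by
  simpa using ketTensor_form 1 1 φ φ' χ χ'

/-- The normalization constant `1 / √2`. -/
noncomputable def invSqrtTwo : ℂ := ((Real.sqrt 2 : ℝ) : ℂ)⁻¹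

lemma invSqrtTwo_mul_self : invSqrtTwo * invSqrtTwo = 1 / 2 := by
  rw [invSqrtTwo, ← mul_inv, ← Complex.ofReal_mul, Real.mul_self_sqrt (by norm_num)]
  norm_num

lemma star_invSqrtTwo : star invSqrtTwo = invSqrtTwo := by
  simp [invSqrtTwo]

lemma half_le_norm_invSqrtTwo : 1 / 2 ≤ ‖invSqrtTwo‖ := by
  have h : ‖invSqrtTwo‖ * ‖invSqrtTwo‖ = 1 / 2 := by
    rw [← norm_mul, invSqrtTwo_mul_self]; norm_num
  nlinarith [norm_nonneg invSqrtTwo]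

lemma ketPM_eq (s : ℂ) (i j : Fin 3) : ketPM s i j = invSqrtTwo • (ket i + s • ket j) := rfl

lemma ket_form (A : Matrix (Fin 3) (Fin 3) ℂ) (i j : Fin 3) :
    star (ket i) ⬝ᵥ A *ᵥ ket j = A i j := by
  have : star (ket i) = ket i := by
    ext k; simp [ket, Pi.single_apply, apply_ite]
  rw [this]; simp [ket]

lemma ket_ketPM_form (A : Matrix (Fin 3) (Fin 3) ℂ) (s : ℂ) (i j k : Fin 3) :
    star (ket i) ⬝ᵥ A *ᵥ ketPM s j k = invSqrtTwo * (A i j + s * A i k) := by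
  simp [ketPM_eq, Matrix.mulVec_smul, Matrix.mulVec_add, ket_form, mul_add]

lemma ketPM_ket_form (A : Matrix (Fin 3) (Fin 3) ℂ) (s : ℂ) (i j k : Fin 3) :
    star (ketPM s j k) ⬝ᵥ A *ᵥ ket i = invSqrtTwo * (A j i + star s * A k i) := by
  rw [ketPM_eq, star_smul, star_add, star_smul, star_invSqrtTwo]
  simp [ket_form, mul_add]

lemma ketPM_form (A : Matrix (Fin 3) (Fin 3) ℂ) (s t : ℂ) (i j k l : Fin 3) :
    star (ketPM s i j) ⬝ᵥ A *ᵥ ketPM t k l =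
      1 / 2 * (A i k + t * A i l + star s * (A j k + t * A j l)) := by
  rw [ketPM_eq s, star_smul, star_add, star_smul, star_invSqrtTwo, smul_dotProduct,
    add_dotProduct, smul_dotProduct, ket_ketPM_form, ket_ketPM_form, ← invSqrtTwo_mul_self]
  simp only [smul_eq_mul]
  ring

lemma psi_dot (s t : ℂ) (i j : Fin 4) :
    star (psi s i) ⬝ᵥ psi t j = if i = j then (1 + star s * t) / 2 else 0 := by
  have h := fun s t i j k l => ketPM_form 1 s t i j k l
  have h1 := fun s i j k => ketPM_ket_form 1 s i j k
  have h2 := fun s i j k => ket_ketPM_form 1 s i j k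
  have h3 := fun i j => ket_form 1 i j
  simp only [Matrix.one_mulVec] at h h1 h2 h3
  fin_cases i <;> fin_cases j <;>
    simp [psi, ketTensor_dot, h, h1, h2, h3] <;> ring

lemma psiZero_dot_psi (t : ℂ) (j : Fin 4) : star psiZero ⬝ᵥ psi t j = 0 := by
  have h2 := fun s i j k => ket_ketPM_form 1 s i j k
  have h3 := fun i j => ket_form 1 i j
  simp only [Matrix.one_mulVec] at h2 h3
  fin_cases j <;> simp [psi, psiZero, ketTensor_dot, h2, h3]

lemma psiZero_dot_psiZero : star psiZero ⬝ᵥ psiZero = 1 := by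
  have h3 := fun i j => ket_form 1 i j
  simp only [Matrix.one_mulVec] at h3
  simp [psiZero, ketTensor_dot, h3]

/-- The projector onto the support of `σ`. -/
noncomputable def sigmaProj : BipOp 3 3 := ∑ i, ketbra (psi 1 i)

/-- The projector onto the support of `ρ`. -/
noncomputable def rhoProj : BipOp 3 3 := ketbra psiZero + ∑ i, ketbra (psi (-1) i)

lemma sigmaState_eq : sigmaState = (1 / 4 : ℂ) • sigmaProj := rfl

lemma rhoState_eq : rhoState = (1 / 5 : ℂ) • rhoProj := rfl

lemma ketbra_mul_ketbra {ι : Type} [Fintype ι] (x y : ι → ℂ) :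
    ketbra x * ketbra y = (star x ⬝ᵥ y) • Matrix.vecMulVec x (star y) := by
  rw [ketbra, ketbra, Matrix.vecMulVec_mul_vecMulVec, Matrix.vecMulVec_smul]

lemma rhoProj_mul_sigmaProj : rhoProj * sigmaProj = 0 := by
  rw [rhoProj, sigmaProj, add_mul, Finset.mul_sum, Finset.sum_mul_sum]
  simp [ketbra_mul_ketbra, psiZero_dot_psi, psi_dot]

lemma trace_ketbra {ι : Type} [Fintype ι] (x : ι → ℂ) : (ketbra x).trace = star x ⬝ᵥ x := by
  rw [ketbra, Matrix.trace_vecMulVec, dotProduct_comm]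

lemma trace_sigmaProj : sigmaProj.trace = 4 := by
  rw [sigmaProj, Matrix.trace_sum]
  simp [trace_ketbra, psi_dot]

lemma trace_rhoProj : rhoProj.trace = 5 := by
  rw [rhoProj, Matrix.trace_add, Matrix.trace_sum]
  simp [trace_ketbra, psi_dot, psiZero_dot_psiZero]
  norm_num

lemma ketbra_ketPM_apply (s : ℂ) (i j k l : Fin 3) : ketbra (ketPM s i j) k l =
    1 / 2 * ((ket i k + s * ket j k) * star (ket i l + s * ket j l)) := by
  simp only [ketbra, Matrix.vecMulVec_apply, ketPM_eq, Pi.smul_apply, Pi.star_apply, Pi.add_apply,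
    smul_eq_mul, star_mul', star_invSqrtTwo, ← invSqrtTwo_mul_self]
  ring

lemma ketbra_ketPM_add (i j : Fin 3) : ketbra (ketPM (-1) i j) + ketbra (ketPM 1 i j) =
    ketbra (ket i) + ketbra (ket j) := by
  ext k l
  simp only [Matrix.add_apply, ketbra_ketPM_apply]
  simp [ketbra, Matrix.vecMulVec_apply]
  ring

/-- Each pair `±` spans the same plane as two computational basis vectors, so the nine projectors
regroup into the computational product projectors. -/
lemma rhoProj_add_sigmaProj : rhoProj + sigmaProj = 1 := by
  have e : rhoProj + sigmaProj = ketbra (ket 1) ⊗ₖ ketbra (ket 1)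
      + ketbra (ket 0) ⊗ₖ (ketbra (ketPM (-1) 0 1) + ketbra (ketPM 1 0 1))
      + (ketbra (ketPM (-1) 0 1) + ketbra (ketPM 1 0 1)) ⊗ₖ ketbra (ket 2)
      + (ketbra (ketPM (-1) 1 2) + ketbra (ketPM 1 1 2)) ⊗ₖ ketbra (ket 0)
      + ketbra (ket 2) ⊗ₖ (ketbra (ketPM (-1) 1 2) + ketbra (ketPM 1 1 2)) := by
    simp only [rhoProj, sigmaProj, Fin.sum_univ_four, psiZero, psi, Matrix.cons_val,
      ketbra_ketTensor, Matrix.add_kronecker, Matrix.kronecker_add]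
    abel
  have one : ∑ i, ketbra (ket i) = (1 : Matrix (Fin 3) (Fin 3) ℂ) := by
    ext k l
    rw [Matrix.sum_apply]
    simp only [ketbra, Matrix.vecMulVec_apply, ket, Pi.star_apply, Matrix.one_apply,
      Pi.single_apply]
    by_cases h : k = l <;> simp [h, apply_ite]
  rw [e, ← Matrix.one_kronecker_one, ← one]
  simp only [ketbra_ketPM_add, Fin.sum_univ_three, Matrix.add_kronecker, Matrix.kronecker_add]
  abel

lemma rhoProj_mul_self : rhoProj * rhoProj = rhoProj := by
  have h := congrArg (rhoProj * ·) rhoProj_add_sigmaProj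
  simpa [mul_add, rhoProj_mul_sigmaProj] using h

lemma sigmaProj_mul_self : sigmaProj * sigmaProj = sigmaProj := by
  have h := congrArg (· * sigmaProj) rhoProj_add_sigmaProj
  simpa [add_mul, rhoProj_mul_sigmaProj] using h

lemma posSemidef_rhoProj : rhoProj.PosSemidef :=
  (posSemidef_ketbra _).add (Matrix.posSemidef_sum _ fun _ _ => posSemidef_ketbra _)

lemma posSemidef_sigmaProj : sigmaProj.PosSemidef :=
  Matrix.posSemidef_sum _ fun _ _ => posSemidef_ketbra _

lemma posSemidef_rhoState : rhoState.PosSemidef :=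
  posSemidef_rhoProj.smul (by norm_num [Complex.le_def])

lemma posSemidef_sigmaState : sigmaState.PosSemidef :=
  posSemidef_sigmaProj.smul (by norm_num [Complex.le_def])

lemma trace_rhoState : rhoState.trace = 1 := by
  simp [rhoState_eq, trace_rhoProj]

lemma trace_sigmaState : sigmaState.trace = 1 := by
  simp [sigmaState_eq, trace_sigmaProj]

lemma rhoState_mul_sigmaState : rhoState * sigmaState = 0 := by
  simp [rhoState_eq, sigmaState_eq, rhoProj_mul_sigmaProj]

/-! ### Product operators close to a multiple of the identity -/

/-- The distance of `A` from the multiple of the identity that has the same trace. -/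
noncomputable def deviation (A : Matrix (Fin 3) (Fin 3) ℂ) : ℝ :=
  ∑ i, ∑ j, ‖A i j - A.trace / 3 * (1 : Matrix (Fin 3) (Fin 3) ℂ) i j‖

/-- `A` is positive semidefinite and, relative to its trace, close to a multiple of `1`. -/
structure NearIdentity (A : Matrix (Fin 3) (Fin 3) ℂ) : Prop where
  posSemidef : A.PosSemidef
  deviation_le : deviation A ≤ A.trace.re / 100

lemma trace_eq_ofReal {ι : Type} [Fintype ι] {A : Matrix ι ι ℂ} (hA : A.PosSemidef) :
    A.trace = (A.trace.re : ℂ) :=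
  Complex.ext rfl (by simpa using (Complex.le_def.mp hA.trace_nonneg).2.symm)

lemma re_trace_nonneg {ι : Type} [Fintype ι] {A : Matrix ι ι ℂ} (hA : A.PosSemidef) :
    0 ≤ A.trace.re :=
  (Complex.le_def.mp hA.trace_nonneg).1

lemma re_trace_kronecker {m n : ℕ} {A : Matrix (Fin m) (Fin m) ℂ} {B : Matrix (Fin n) (Fin n) ℂ}
    (hA : A.PosSemidef) : (A ⊗ₖ B).trace.re = A.trace.re * B.trace.re := by
  rw [Matrix.trace_kronecker, trace_eq_ofReal hA, Complex.re_ofReal_mul, Complex.ofReal_re]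

lemma norm_sub_le_deviation (A : Matrix (Fin 3) (Fin 3) ℂ) (i j : Fin 3) :
    ‖A i j - A.trace / 3 * (1 : Matrix (Fin 3) (Fin 3) ℂ) i j‖ ≤ deviation A :=
  (Finset.single_le_sum (f := fun j => ‖A i j - A.trace / 3 * (1 : Matrix _ _ ℂ) i j‖)
    (fun _ _ => norm_nonneg _) (Finset.mem_univ j)).trans
  (Finset.single_le_sum
    (f := fun i => ∑ j, ‖A i j - A.trace / 3 * (1 : Matrix _ _ ℂ) i j‖)
    (fun _ _ => Finset.sum_nonneg fun _ _ => norm_nonneg _) (Finset.mem_univ i))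

namespace NearIdentity

variable {A : Matrix (Fin 3) (Fin 3) ℂ}

lemma norm_offDiag_le (h : NearIdentity A) {i j : Fin 3} (hij : i ≠ j) :
    ‖A i j‖ ≤ A.trace.re / 100 := by
  have := (norm_sub_le_deviation A i j).trans h.deviation_le
  rwa [Matrix.one_apply_ne hij, mul_zero, sub_zero] at this

lemma le_norm_diag (h : NearIdentity A) (i : Fin 3) :
    97 / 300 * A.trace.re ≤ ‖A i i‖ := by
  have h1 := (norm_sub_le_deviation A i i).trans h.deviation_le
  rw [Matrix.one_apply_eq, mul_one, norm_sub_rev] at h1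
  have h2 := norm_sub_norm_le (A.trace / 3) (A i i)
  have h3 : ‖A.trace / 3‖ = A.trace.re / 3 := by
    rw [trace_eq_ofReal h.posSemidef, norm_div, Complex.norm_real, Real.norm_eq_abs,
      abs_of_nonneg (re_trace_nonneg h.posSemidef), Complex.ofReal_re]
    norm_num
  linarith

/-- These are the cofactors divided out in `gap_of_boundary`. The constant is safe because `(97/300
- 1/100) / 2 > 1/8`. -/
lemma le_norm_diag_add (h : NearIdentity A) {i j k : Fin 3} (hjk : j ≠ k) :
    A.trace.re / 8 ≤ ‖invSqrtTwo * (A i i + A j k)‖ := by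
  have h1 := h.le_norm_diag i
  have h2 := h.norm_offDiag_le hjk
  have h3 := norm_sub_le_norm_add (A i i) (A j k)
  have h4 := re_trace_nonneg h.posSemidef
  rw [norm_mul]
  nlinarith [half_le_norm_invSqrtTwo, norm_nonneg (A i i + A j k)]

end NearIdentity

lemma norm_le_of_norm_mul_le {z w : ℂ} {t a b : ℝ} (hb : 0 < b) (hw : b / 8 ≤ ‖w‖)
    (h : ‖z * w‖ ≤ t * (a * b)) : ‖z‖ ≤ 8 * (t * a) := by
  rw [norm_mul] at h
  have h1 : ‖z‖ * (b / 8) ≤ ‖z‖ * ‖w‖ := mul_le_mul_of_nonneg_left hw (norm_nonneg z)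
  refine le_of_mul_le_mul_right ?_ hb
  linarith

lemma norm_le_of_norm_invSqrtTwo_mul_le {z : ℂ} {t : ℝ} (h : ‖invSqrtTwo * z‖ ≤ t) :
    ‖z‖ ≤ 2 * t := by
  rw [norm_mul] at h
  nlinarith [half_le_norm_invSqrtTwo, norm_nonneg z]

/-- The five quantities are the factors that the orthogonality relations control, the same ones for
Alice and for Bob. They bound the off-diagonal entries by `8t`, `8t`, `24t` and the differences of
diagonal entries by `32t`, `32t`, `64t`; summing all nine deviations stays below `176 * t`. -/
lemma deviation_le_of_norm_le {A : Matrix (Fin 3) (Fin 3) ℂ} (hA : A.PosSemidef) {t : ℝ}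
    (h10 : ‖A 1 0‖ ≤ 8 * t) (h12 : ‖A 1 2‖ ≤ 8 * t)
    (h02 : ‖invSqrtTwo * (A 0 2 + star (-1) * A 1 2)‖ ≤ 8 * t)
    (h01 : ‖1 / 2 * (A 0 0 + 1 * A 0 1 + star (-1) * (A 1 0 + 1 * A 1 1))‖ ≤ 8 * t)
    (h11 : ‖1 / 2 * (A 1 1 + 1 * A 1 2 + star (-1) * (A 2 1 + 1 * A 2 2))‖ ≤ 8 * t) :
    deviation A ≤ 176 * t := by
  have herm : ∀ i j, ‖A i j‖ = ‖A j i‖ := fun i j => by rw [← hA.1.apply i j, norm_star]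
  have n02 : ‖A 0 2‖ ≤ 24 * t := by
    have h := norm_le_of_norm_invSqrtTwo_mul_le h02
    have e : A 0 2 = (A 0 2 + star (-1) * A 1 2) + A 1 2 := by simp
    rw [e]
    linarith [norm_add_le (A 0 2 + star (-1) * A 1 2) (A 1 2)]
  have diff : ∀ i j, ‖1 / 2 * (A i i + 1 * A i j + star (-1) * (A j i + 1 * A j j))‖ ≤ 8 * t →
      ‖A j i‖ ≤ 8 * t → ‖A i i - A j j‖ ≤ 32 * t := by
    intro i j h hji
    rw [norm_mul] at h
    norm_num at h
    have e : A i i - A j j = (A i i + A i j + (-A j j + -A j i)) + (A j i - A i j) := by ring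
    have h1 := norm_add_le (A i i + A i j + (-A j j + -A j i)) (A j i - A i j)
    have h2 := norm_sub_le (A j i) (A i j)
    rw [← e] at h1
    rw [herm i j] at h2
    linarith
  have d01 := diff 0 1 h01 h10
  have d12 := diff 1 2 h11 (by rwa [herm])
  have d02 : ‖A 0 0 - A 2 2‖ ≤ 64 * t := by
    have := norm_add_le (A 0 0 - A 1 1) (A 1 1 - A 2 2)
    rw [sub_add_sub_cancel] at this
    linarith
  have diag : ∀ i j k, A.trace = A i i + A j j + A k k → ∀ s u, ‖A i i - A j j‖ ≤ s →
      ‖A i i - A k k‖ ≤ u → ‖A i i - A.trace / 3‖ ≤ (s + u) / 3 := by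
    intro i j k e s u hs hu
    -- The deviation from the mean of the diagonal is a third of the sum of the differences to the
    -- other two entries.
    have e' : A i i - A.trace / 3 = ((A i i - A j j) + (A i i - A k k)) / 3 := by rw [e]; ring
    have := norm_add_le (A i i - A j j) (A i i - A k k)
    rw [e', norm_div]
    norm_num
    linarith
  have tr := Matrix.trace_fin_three A
  have D0 := diag 0 1 2 tr _ _ d01 d02
  have D1 := diag 1 0 2 (by rw [tr]; ring) _ _ ((norm_sub_rev _ _).trans_le d01) d12
  have D2 := diag 2 0 1 (by rw [tr]; ring) _ _ ((norm_sub_rev _ _).trans_le d02)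
    ((norm_sub_rev _ _).trans_le d12)
  have r01 := herm 0 1
  have r21 := herm 2 1
  have r20 := herm 2 0
  have t0 := (norm_nonneg _).trans h10
  simp only [deviation, Fin.sum_univ_three, Matrix.one_apply, Fin.reduceEq, if_true, if_false,
    mul_one, mul_zero, sub_zero]
  linarith

/-! ### The gap on the boundary of the neighbourhood of the identity -/

/-- The total error probability of a measurement `(F, F')` of `ρ` and `σ`. -/
noncomputable def cost (F F' : BipOp 3 3) : ℝ :=
  ((F * sigmaState).trace + (F' * rhoState).trace).re

lemma cost_nonneg {F F' : BipOp 3 3} (hF : F.PosSemidef) (hF' : F'.PosSemidef) :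
    0 ≤ cost F F' :=
  add_nonneg (re_trace_mul_nonneg hF posSemidef_sigmaState)
    (re_trace_mul_nonneg hF' posSemidef_rhoState)

lemma posSemidef_sum_sub {ι κ : Type} [Fintype κ] [DecidableEq κ] [Fintype ι]
    (f : κ → Matrix ι ι ℂ) (hf : ∀ i, (f i).PosSemidef) (i : κ) :
    (∑ j, f j - f i).PosSemidef := by
  rw [← Finset.sum_erase_eq_sub (Finset.mem_univ i)]
  exact Matrix.posSemidef_sum _ fun _ _ => hf _

lemma posSemidef_sigmaProj_sub (i : Fin 4) : (sigmaProj - ketbra (psi 1 i)).PosSemidef :=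
  posSemidef_sum_sub _ (fun _ => posSemidef_ketbra _) i

lemma posSemidef_rhoProj_sub (i : Fin 4) : (rhoProj - ketbra (psi (-1) i)).PosSemidef := by
  rw [rhoProj, add_sub_assoc]
  exact (posSemidef_ketbra _).add
    (posSemidef_sum_sub (fun i => ketbra (psi (-1) i)) (fun _ => posSemidef_ketbra _) i)

lemma posSemidef_rhoProj_sub_psiZero : (rhoProj - ketbra psiZero).PosSemidef := by
  rw [rhoProj, add_sub_cancel_left]
  exact Matrix.posSemidef_sum _ fun _ _ => posSemidef_ketbra _

lemma re_form_le {F G : BipOp 3 3} (hF : F.PosSemidef) {x : Fin 3 × Fin 3 → ℂ}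
    (h : (G - ketbra x).PosSemidef) : (star x ⬝ᵥ F *ᵥ x).re ≤ (F * G).trace.re := by
  have := re_trace_mul_nonneg hF h
  rw [mul_sub, Matrix.trace_sub, trace_mul_ketbra, Complex.sub_re] at this
  linarith

lemma re_trace_mul_rhoProj (F : BipOp 3 3) :
    (F * rhoProj).trace.re = 5 * (F * rhoState).trace.re := by
  rw [rhoState_eq, Matrix.mul_smul, Matrix.trace_smul, smul_eq_mul, Complex.mul_re]
  norm_num
  ring

lemma re_trace_mul_sigmaProj (F : BipOp 3 3) :
    (F * sigmaProj).trace.re = 4 * (F * sigmaState).trace.re := by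
  rw [sigmaState_eq, Matrix.mul_smul, Matrix.trace_smul, smul_eq_mul, Complex.mul_re]
  norm_num
  ring

lemma re_trace_eq_add (F : BipOp 3 3) :
    F.trace.re = (F * rhoProj).trace.re + (F * sigmaProj).trace.re := by
  rw [← Complex.add_re, ← Matrix.trace_add, ← mul_add, rhoProj_add_sigmaProj, mul_one]

/-- A measurement with a small error nearly preserves the orthogonality of the supports. -/
lemma norm_form_le_of_cost_lt {E F F' : BipOp 3 3} (hF : F.PosSemidef) (hF' : F'.PosSemidef)
    (hE : F + F' = E) (hc : cost F F' < E.trace.re / 32000000000) {x y : Fin 3 × Fin 3 → ℂ}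
    (hx : (rhoProj - ketbra x).PosSemidef) (hy : (sigmaProj - ketbra y).PosSemidef) :
    ‖star x ⬝ᵥ E *ᵥ y‖ ≤ 1 / 40000 * E.trace.re := by
  have e : star x ⬝ᵥ E *ᵥ y = star x ⬝ᵥ F *ᵥ y + star x ⬝ᵥ F' *ᵥ y := by
    rw [← hE, Matrix.add_mulVec, dotProduct_add]
  have t : E.trace.re = F.trace.re + F'.trace.re := by
    rw [← hE, Matrix.trace_add, Complex.add_re]
  -- `F` is small on `y` and `F'` is small on `x`, so opposite weights are used. The large weight
  -- multiplies the error by at most `200000`, which contributes at most `1/160000` of the trace;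
  -- the small weight contributes as much again.
  have c1 := norm_form_le hF (κ := 1 / 80000) (by norm_num) x y
  have c2 := norm_form_le hF' (κ := 80000) (by norm_num) x y
  have x1 := re_form_le hF hx
  have x2 := re_form_le hF' hx
  have y1 := re_form_le hF hy
  have y2 := re_form_le hF' hy
  have t1 := re_trace_eq_add F
  have t2 := re_trace_eq_add F'
  have p1 := re_trace_mul_nonneg hF posSemidef_rhoState
  have p2 := re_trace_mul_nonneg hF posSemidef_sigmaState
  have p3 := re_trace_mul_nonneg hF' posSemidef_rhoState
  have p4 := re_trace_mul_nonneg hF' posSemidef_sigmaState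
  rw [re_trace_mul_rhoProj] at x1 x2 t1 t2
  rw [re_trace_mul_sigmaProj] at y1 y2 t1 t2
  rw [cost, Complex.add_re] at hc
  have n := norm_add_le (star x ⬝ᵥ F *ᵥ y) (star x ⬝ᵥ F' *ᵥ y)
  rw [e]
  norm_num at c1 c2
  linarith

/-- A smaller error would give both factors relative deviation at most `176/40000 < 1/100`, which
excludes equality for either. -/
lemma gap_of_boundary {A B : Matrix (Fin 3) (Fin 3) ℂ} (hA : NearIdentity A) (hB : NearIdentity B)
    (ha : 0 < A.trace.re) (hb : 0 < B.trace.re)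
    (h : deviation A = A.trace.re / 100 ∨ deviation B = B.trace.re / 100)
    {F F' : BipOp 3 3} (hF : F.PosSemidef) (hF' : F'.PosSemidef) (hE : F + F' = A ⊗ₖ B) :
    A.trace.re * B.trace.re / 32000000000 ≤ cost F F' := by
  by_contra! hc
  rw [← re_trace_kronecker hA.posSemidef] at hc
  have key := fun x y hx hy => norm_form_le_of_cost_lt hF hF' hE hc (x := x) (y := y) hx hy
  rw [re_trace_kronecker hA.posSemidef] at key
  have kz := fun j => key _ _ posSemidef_rhoProj_sub_psiZero (posSemidef_sigmaProj_sub j)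
  have kp := fun i j => key _ _ (posSemidef_rhoProj_sub i) (posSemidef_sigmaProj_sub j)
  have comm : A.trace.re * B.trace.re = B.trace.re * A.trace.re := mul_comm _ _
  -- Ten orthogonality relations suffice: `z0`, `z3`, `c1`, `r1`, `r2` constrain `A`, and `z2`,
  -- `z1`, `c0`, `r0`, `r3` constrain `B`. In each, the other factor is bounded below.
  have z0 := kz 0
  have z1 := kz 1
  have z2 := kz 2
  have z3 := kz 3
  have r0 := kp 0 0
  have r1 := kp 1 1
  have r2 := kp 2 2
  have r3 := kp 3 3
  have c0 := kp 0 1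
  have c1 := kp 1 3
  simp only [psi, psiZero, Matrix.cons_val, ketTensor_form, ket_form, ket_ketPM_form,
    ketPM_ket_form, one_mul] at z0 z1 z2 z3 c0 c1
  simp only [psi, Matrix.cons_val, ketTensor_form, ket_form, ketPM_form] at r0 r1 r2 r3
  have diagA := fun i => (hA.le_norm_diag i).trans' (by linarith : A.trace.re / 8 ≤ _)
  have diagB := fun i => (hB.le_norm_diag i).trans' (by linarith : B.trace.re / 8 ≤ _)
  have dA : deviation A ≤ 176 * (1 / 40000 * A.trace.re) := by
    refine deviation_le_of_norm_le hA.posSemidef ?_ ?_ ?_ ?_ ?_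
    · refine norm_le_of_norm_mul_le hb ?_ z0
      rw [add_comm]
      exact hB.le_norm_diag_add (by decide)
    · exact norm_le_of_norm_mul_le hb (hB.le_norm_diag_add (by decide)) z3
    · refine norm_le_of_norm_mul_le hb ?_ c1
      rw [add_comm]
      exact hB.le_norm_diag_add (by decide)
    · exact norm_le_of_norm_mul_le hb (diagB 2) r1
    · exact norm_le_of_norm_mul_le hb (diagB 0) r2
  rw [comm] at z0 z1 z2 z3 r0 r1 r2 r3 c0 c1
  rw [mul_comm (_ * _ : ℂ)] at c0
  have dB : deviation B ≤ 176 * (1 / 40000 * B.trace.re) := by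
    refine deviation_le_of_norm_le hB.posSemidef ?_ ?_ ?_ ?_ ?_
    · rw [mul_comm (_ * _ : ℂ)] at z2
      exact norm_le_of_norm_mul_le ha (hA.le_norm_diag_add (by decide)) z2
    · rw [mul_comm (_ * _ : ℂ), add_comm] at z1
      exact norm_le_of_norm_mul_le ha (hA.le_norm_diag_add (by decide)) z1
    · exact norm_le_of_norm_mul_le ha (hA.le_norm_diag_add (by decide)) c0
    · rw [mul_comm (A 0 0)] at r0
      exact norm_le_of_norm_mul_le ha (diagA 0) r0
    · rw [mul_comm (A 2 2)] at r3
      exact norm_le_of_norm_mul_le ha (diagA 2) r3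
  rcases h with h | h <;> linarith

/-! ### LOCC protocols -/

namespace LOCCProtocol

lemma posSemidef_effect (b : Bool) {m n : ℕ} (P : LOCCProtocol m n) :
    (P.effect b).PosSemidef := by
  induction P with
  | guess g =>
    rw [effect]
    split_ifs
    exacts [.one, .zero]
  | alice k d K hK next ih =>
    rw [effect]
    exact Matrix.posSemidef_sum _ fun i _ => (ih i).conjTranspose_mul_mul_same _
  | bob k d K hK next ih =>
    rw [effect]
    exact Matrix.posSemidef_sum _ fun i _ => (ih i).conjTranspose_mul_mul_same _

lemma effect_true_add_effect_false {m n : ℕ} (P : LOCCProtocol m n) :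
    P.effect true + P.effect false = 1 := by
  induction P with
  | guess g => cases g <;> simp [effect]
  | alice k d K hK next ih =>
    simp only [effect, ← Finset.sum_add_distrib, ← Matrix.add_mul, ← Matrix.mul_add, ih,
      Matrix.mul_one, Matrix.conjTranspose_kronecker, ← Matrix.mul_kronecker_mul,
      Matrix.conjTranspose_one]
    rw [← Matrix.one_kronecker_one, ← hK]
    ext p q
    simp [Matrix.sum_apply, Matrix.kroneckerMap_apply, Finset.sum_mul]
  | bob k d K hK next ih =>
    simp only [effect, ← Finset.sum_add_distrib, ← Matrix.add_mul, ← Matrix.mul_add, ih,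
      Matrix.mul_one, Matrix.conjTranspose_kronecker, ← Matrix.mul_kronecker_mul,
      Matrix.conjTranspose_one]
    rw [← Matrix.one_kronecker_one, ← hK]
    ext p q
    simp [Matrix.sum_apply, Matrix.kroneckerMap_apply, Finset.mul_sum]

end LOCCProtocol

/-! ### Error of a guess near the identity, and crossing the boundary -/

lemma le_re_trace_sigmaState {A B : Matrix (Fin 3) (Fin 3) ℂ} (hA : NearIdentity A)
    (hB : NearIdentity B) :
    A.trace.re * B.trace.re / 32000000000 ≤ ((A ⊗ₖ B) * sigmaState).trace.re := by
  have hE := hA.posSemidef.kronecker hB.posSemidef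
  have h := re_form_le hE (posSemidef_sigmaProj_sub 0)
  rw [re_trace_mul_sigmaProj] at h
  have e : (star (psi 1 0) ⬝ᵥ (A ⊗ₖ B) *ᵥ psi 1 0).re = ‖star (psi 1 0) ⬝ᵥ (A ⊗ₖ B) *ᵥ psi 1 0‖ :=
    (congrArg Complex.re (Complex.eq_coe_norm_of_nonneg (hE.dotProduct_mulVec_nonneg _))).trans
      (Complex.ofReal_re _)
  rw [e] at h
  simp only [psi, Matrix.cons_val, ketTensor_form, ket_form, ketPM_form] at h
  have a1 := hA.le_norm_diag 0
  have b1 := hB.le_norm_diag 0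
  have b2 := hB.norm_offDiag_le (i := 0) (j := 1) (by decide)
  have b3 := hB.norm_offDiag_le (i := 1) (j := 0) (by decide)
  have ha := re_trace_nonneg hA.posSemidef
  have hb := re_trace_nonneg hB.posSemidef
  have real : ∀ i, (B i i).re = ‖B i i‖ := fun i =>
    (congrArg Complex.re (Complex.eq_coe_norm_of_nonneg hB.posSemidef.diag_nonneg)).trans
      (Complex.ofReal_re _)
  have lower : B.trace.re / 8 ≤
      ‖1 / 2 * (B 0 0 + 1 * B 0 1 + star 1 * (B 1 0 + 1 * B 1 1))‖ := by
    refine le_trans ?_ (Complex.re_le_norm _)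
    have r1 := (abs_le.mp (Complex.abs_re_le_norm (B 0 1))).1
    have r2 := (abs_le.mp (Complex.abs_re_le_norm (B 1 0))).1
    have d0 := real 0
    have d1 := real 1
    have n1 := norm_nonneg (B 1 1)
    simp only [one_mul, star_one, Complex.mul_re, Complex.add_re]
    norm_num
    linarith
  rw [norm_mul] at h
  have := mul_le_mul (a1.trans' (by linarith : A.trace.re / 8 ≤ _)) lower (by positivity)
    (norm_nonneg _)
  have p := mul_nonneg ha hb
  linarith

lemma le_re_trace_rhoState {A B : Matrix (Fin 3) (Fin 3) ℂ} (hA : NearIdentity A)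
    (hB : NearIdentity B) :
    A.trace.re * B.trace.re / 32000000000 ≤ ((A ⊗ₖ B) * rhoState).trace.re := by
  have hE := hA.posSemidef.kronecker hB.posSemidef
  have h := re_form_le hE posSemidef_rhoProj_sub_psiZero
  rw [re_trace_mul_rhoProj] at h
  have e : (star psiZero ⬝ᵥ (A ⊗ₖ B) *ᵥ psiZero).re = ‖star psiZero ⬝ᵥ (A ⊗ₖ B) *ᵥ psiZero‖ :=
    (congrArg Complex.re (Complex.eq_coe_norm_of_nonneg (hE.dotProduct_mulVec_nonneg _))).trans
      (Complex.ofReal_re _)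
  rw [e] at h
  simp only [psiZero, ketTensor_form, ket_form, norm_mul] at h
  have ha := re_trace_nonneg hA.posSemidef
  have hb := re_trace_nonneg hB.posSemidef
  have := mul_le_mul ((hA.le_norm_diag 1).trans' (by linarith : A.trace.re / 8 ≤ _))
    ((hB.le_norm_diag 1).trans' (by linarith : B.trace.re / 8 ≤ _)) (by positivity)
    (norm_nonneg _)
  have p := mul_nonneg ha hb
  linarith

/-- The segment from `A` to `A'` leaves the neighbourhood of the identity through its boundary. -/
lemma exists_boundary {A A' : Matrix (Fin 3) (Fin 3) ℂ} (hA : NearIdentity A)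
    (hpos : A'.PosSemidef) (hA' : A'.trace.re / 100 < deviation A') :
    ∃ s : ℝ, 0 ≤ s ∧ s < 1 ∧ NearIdentity ((1 - s) • A + s • A') ∧
      deviation ((1 - s) • A + s • A') = ((1 - s) • A + s • A').trace.re / 100 := by
  have cont : Continuous fun s : ℝ => deviation ((1 - s) • A + s • A') -
      ((1 - s) • A + s • A').trace.re / 100 := by
    simp only [deviation, Matrix.trace_add, Matrix.trace_smul, Matrix.add_apply,
      Matrix.smul_apply, Complex.add_re]
    fun_prop
  obtain ⟨s, ⟨hs0, hs1⟩, hs⟩ := intermediate_value_Icc zero_le_one cont.continuousOn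
    (show (0 : ℝ) ∈ Set.Icc _ _ by
      simpa using ⟨hA.deviation_le, hA'.le⟩)
  have eq : deviation ((1 - s) • A + s • A') = ((1 - s) • A + s • A').trace.re / 100 :=
    sub_eq_zero.mp hs
  refine ⟨s, hs0, lt_of_le_of_ne hs1 ?_, ⟨?_, eq.le⟩, eq⟩
  · rintro rfl
    simp only [sub_self, zero_smul, one_smul, zero_add] at eq
    exact hA'.ne' eq
  · exact (hA.posSemidef.smul (sub_nonneg.mpr hs1)).add (hpos.smul hs0)

lemma re_trace_segment {ι : Type} [Fintype ι] (A A' : Matrix ι ι ℂ) (s : ℝ) :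
    ((1 - s) • A + s • A').trace.re = (1 - s) * A.trace.re + s * A'.trace.re := by
  simp [Matrix.trace_add, Matrix.trace_smul]

lemma cost_segment (F F' G G' : BipOp 3 3) (s : ℝ) :
    cost ((1 - s) • F + s • G) ((1 - s) • F' + s • G') =
      (1 - s) * cost F F' + s * cost G G' := by
  simp only [cost, Matrix.add_mul, Matrix.smul_mul, Matrix.trace_add, Matrix.trace_smul,
    Complex.add_re, Complex.real_smul, Complex.re_ofReal_mul]
  ring

/-- Both sides are affine in `s`: an inequality that fails at `0` and holds at `s` must hold at `1`.
The case `s = 0` contradicts `hc`. -/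
lemma le_of_segment {s a a' b c c' δ : ℝ} (hs0 : 0 ≤ s) (hs1 : s < 1)
    (h : ((1 - s) * a + s * a') * b / δ ≤ (1 - s) * c + s * c') (hc : c < a * b / δ) :
    a' * b / δ ≤ c' := by
  rcases hs0.eq_or_lt with rfl | hs
  · simp at h
    linarith
  · refine le_of_mul_le_mul_left ?_ hs
    have e : ((1 - s) * a + s * a') * b / δ = (1 - s) * (a * b / δ) + s * (a' * b / δ) := by ring
    have := mul_le_mul_of_nonneg_left hc.le (sub_nonneg.mpr hs1.le)
    linarith

lemma cost_ge_of_leave_left {A A' B : Matrix (Fin 3) (Fin 3) ℂ} (hA : NearIdentity A)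
    (hB : NearIdentity B) (ha : 0 < A.trace.re) (hb : 0 < B.trace.re)
    (hpos : A'.PosSemidef) (hA' : ¬ NearIdentity A') {F F' G G' : BipOp 3 3}
    (hF : F.PosSemidef) (hF' : F'.PosSemidef) (hG : G.PosSemidef) (hG' : G'.PosSemidef)
    (hFE : F + F' = A ⊗ₖ B) (hGE : G + G' = A' ⊗ₖ B)
    (hc : cost F F' < A.trace.re * B.trace.re / 32000000000) :
    A'.trace.re * B.trace.re / 32000000000 ≤ cost G G' := by
  obtain ⟨s, hs0, hs1, near, eq⟩ := exists_boundary hA hpos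
    (lt_of_not_ge fun h => hA' ⟨hpos, h⟩)
  -- The interpolated pair splits the boundary product operator. Its trace is positive because `s <
  -- 1` leaves a positive share of `A`.
  have hs1' := sub_nonneg.mpr hs1.le
  have h := gap_of_boundary near hB
    (by rw [re_trace_segment]; exact add_pos_of_pos_of_nonneg (mul_pos (sub_pos.mpr hs1) ha)
          (mul_nonneg hs0 (re_trace_nonneg hpos))) hb (.inl eq)
    ((hF.smul hs1').add (hG.smul hs0)) ((hF'.smul hs1').add (hG'.smul hs0))
    (by rw [Matrix.add_kronecker, Matrix.smul_kronecker, Matrix.smul_kronecker, ← hFE, ← hGE,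
          smul_add, smul_add]; abel)
  rw [re_trace_segment, cost_segment] at h
  exact le_of_segment hs0 hs1 h hc

lemma cost_ge_of_leave_right {A B B' : Matrix (Fin 3) (Fin 3) ℂ} (hA : NearIdentity A)
    (hB : NearIdentity B) (ha : 0 < A.trace.re) (hb : 0 < B.trace.re)
    (hpos : B'.PosSemidef) (hB' : ¬ NearIdentity B') {F F' G G' : BipOp 3 3}
    (hF : F.PosSemidef) (hF' : F'.PosSemidef) (hG : G.PosSemidef) (hG' : G'.PosSemidef)
    (hFE : F + F' = A ⊗ₖ B) (hGE : G + G' = A ⊗ₖ B')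
    (hc : cost F F' < A.trace.re * B.trace.re / 32000000000) :
    A.trace.re * B'.trace.re / 32000000000 ≤ cost G G' := by
  obtain ⟨s, hs0, hs1, near, eq⟩ := exists_boundary hB hpos
    (lt_of_not_ge fun h => hB' ⟨hpos, h⟩)
  have hs1' := sub_nonneg.mpr hs1.le
  have h := gap_of_boundary hA near ha
    (by rw [re_trace_segment]; exact add_pos_of_pos_of_nonneg (mul_pos (sub_pos.mpr hs1) hb)
          (mul_nonneg hs0 (re_trace_nonneg hpos))) (.inr eq)
    ((hF.smul hs1').add (hG.smul hs0)) ((hF'.smul hs1').add (hG'.smul hs0))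
    (by rw [Matrix.kronecker_add, Matrix.kronecker_smul, Matrix.kronecker_smul, ← hFE, ← hGE,
          smul_add, smul_add]; abel)
  rw [re_trace_segment, cost_segment, mul_comm A.trace.re] at h
  rw [mul_comm A.trace.re] at hc ⊢
  exact le_of_segment hs0 hs1 h hc

/-! ### Induction over the protocol tree -/

lemma cost_sum {k : ℕ} (F F' : Fin k → BipOp 3 3) :
    cost (∑ i, F i) (∑ i, F' i) = ∑ i, cost (F i) (F' i) := by
  simp only [cost, Finset.sum_mul, Matrix.trace_sum, Complex.add_re, Complex.re_sum,
    Finset.sum_add_distrib]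

/-- Completeness of a local measurement makes the claimed lower bound additive over outcomes. -/
lemma re_trace_sum_mul {k m : ℕ} {d : Fin k → ℕ}
    {K : (i : Fin k) → Matrix (Fin (d i)) (Fin m) ℂ}
    (hK : ∑ i, (K i)ᴴ * K i = 1) (X : Matrix (Fin m) (Fin 3) ℂ) :
    ∑ i, ((K i * X)ᴴ * (K i * X)).trace.re = (Xᴴ * X).trace.re := by
  have h : Xᴴ * X = ∑ i, (K i * X)ᴴ * (K i * X) := by
    rw [← Matrix.mul_one Xᴴ, ← hK, Matrix.mul_sum, Matrix.sum_mul]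
    simp only [Matrix.conjTranspose_mul, Matrix.mul_assoc]
  rw [h, Matrix.trace_sum, Complex.re_sum]

/-- The POVM element of the event that a protocol, entered after the local Kraus operators `X`
and `Y`, ends with the guess `b`. -/
noncomputable def pulledEffect {m n : ℕ} (X : Matrix (Fin m) (Fin 3) ℂ)
    (Y : Matrix (Fin n) (Fin 3) ℂ) (P : LOCCProtocol m n) (b : Bool) : BipOp 3 3 :=
  (X ⊗ₖ Y)ᴴ * P.effect b * (X ⊗ₖ Y)

section pulledEffect

variable {m n : ℕ} (X : Matrix (Fin m) (Fin 3) ℂ) (Y : Matrix (Fin n) (Fin 3) ℂ)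

lemma posSemidef_pulledEffect (P : LOCCProtocol m n) (b : Bool) :
    (pulledEffect X Y P b).PosSemidef :=
  (P.posSemidef_effect b).conjTranspose_mul_mul_same _

lemma pulledEffect_add (P : LOCCProtocol m n) :
    pulledEffect X Y P true + pulledEffect X Y P false = (Xᴴ * X) ⊗ₖ (Yᴴ * Y) := by
  rw [pulledEffect, pulledEffect, ← Matrix.add_mul, ← Matrix.mul_add,
    P.effect_true_add_effect_false, Matrix.mul_one, Matrix.conjTranspose_kronecker,
    ← Matrix.mul_kronecker_mul]

lemma pulledEffect_alice {k : ℕ} {d : Fin k → ℕ} {K : (i : Fin k) → Matrix (Fin (d i)) (Fin m) ℂ}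
    (hK : ∑ i, (K i)ᴴ * K i = 1) (next : (i : Fin k) → LOCCProtocol (d i) n) (b : Bool) :
    pulledEffect X Y (.alice k d K hK next) b =
      ∑ i, pulledEffect (K i * X) Y (next i) b := by
  have e : ∀ i, (K i * X) ⊗ₖ Y = (K i ⊗ₖ (1 : Matrix (Fin n) (Fin n) ℂ)) * (X ⊗ₖ Y) := fun i => by
    rw [← Matrix.mul_kronecker_mul, Matrix.one_mul]
  simp only [pulledEffect, LOCCProtocol.effect, e, Matrix.conjTranspose_mul, Matrix.mul_sum,
    Matrix.sum_mul, Matrix.mul_assoc]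

lemma pulledEffect_bob {k : ℕ} {d : Fin k → ℕ} {K : (i : Fin k) → Matrix (Fin (d i)) (Fin n) ℂ}
    (hK : ∑ i, (K i)ᴴ * K i = 1) (next : (i : Fin k) → LOCCProtocol m (d i)) (b : Bool) :
    pulledEffect X Y (.bob k d K hK next) b =
      ∑ i, pulledEffect X (K i * Y) (next i) b := by
  have e : ∀ i, X ⊗ₖ (K i * Y) = ((1 : Matrix (Fin m) (Fin m) ℂ) ⊗ₖ K i) * (X ⊗ₖ Y) := fun i => by
    rw [← Matrix.mul_kronecker_mul, Matrix.one_mul]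
  simp only [pulledEffect, LOCCProtocol.effect, e, Matrix.conjTranspose_mul, Matrix.mul_sum,
    Matrix.sum_mul, Matrix.mul_assoc]

end pulledEffect

/-- As long as the accumulated product operator is near the identity, the remaining protocol has
an error bounded below. -/
theorem cost_pulledEffect_ge {m n : ℕ} (P : LOCCProtocol m n) (X : Matrix (Fin m) (Fin 3) ℂ)
    (Y : Matrix (Fin n) (Fin 3) ℂ) (hX : NearIdentity (Xᴴ * X)) (hY : NearIdentity (Yᴴ * Y)) :
    (Xᴴ * X).trace.re * (Yᴴ * Y).trace.re / 32000000000 ≤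
      cost (pulledEffect X Y P true) (pulledEffect X Y P false) := by
  have nonneg := cost_nonneg (posSemidef_pulledEffect X Y P true)
    (posSemidef_pulledEffect X Y P false)
  rcases (re_trace_nonneg hX.posSemidef).eq_or_lt with ha | ha
  · simpa [← ha] using nonneg
  rcases (re_trace_nonneg hY.posSemidef).eq_or_lt with hb | hb
  · simpa [← hb] using nonneg
  clear nonneg
  induction P with
  | guess g =>
    have e : (X ⊗ₖ Y)ᴴ * (X ⊗ₖ Y) = (Xᴴ * X) ⊗ₖ (Yᴴ * Y) := by
      rw [Matrix.conjTranspose_kronecker, ← Matrix.mul_kronecker_mul]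
    cases g
    · simpa [cost, pulledEffect, LOCCProtocol.effect, e] using le_re_trace_rhoState hX hY
    · simpa [cost, pulledEffect, LOCCProtocol.effect, e] using le_re_trace_sigmaState hX hY
  | alice k d K hK next ih =>
    -- The negated bound at this node is the input `hc` needed for outcomes that leave the
    -- neighbourhood.
    by_contra! hc
    refine hc.not_ge ?_
    rw [pulledEffect_alice, pulledEffect_alice, cost_sum, ← re_trace_sum_mul hK X, Finset.sum_mul,
      Finset.sum_div]
    refine Finset.sum_le_sum fun i _ => ?_
    by_cases hi : NearIdentity ((K i * X)ᴴ * (K i * X))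
    -- Outcomes of trace zero count as near the identity, but the induction hypothesis requires
    -- positive trace.
    · rcases (re_trace_nonneg hi.posSemidef).eq_or_lt with hi0 | hi0
      · rw [← hi0, zero_mul, zero_div]
        exact cost_nonneg (posSemidef_pulledEffect ..) (posSemidef_pulledEffect ..)
      · exact ih i _ _ hi hY hi0 hb
    · exact cost_ge_of_leave_left hX hY ha hb (Matrix.posSemidef_conjTranspose_mul_self _) hi
        (posSemidef_pulledEffect ..) (posSemidef_pulledEffect ..)
        (posSemidef_pulledEffect ..) (posSemidef_pulledEffect ..)
        (pulledEffect_add ..) (pulledEffect_add ..) hc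
  | bob k d K hK next ih =>
    by_contra! hc
    refine hc.not_ge ?_
    rw [pulledEffect_bob, pulledEffect_bob, cost_sum, ← re_trace_sum_mul hK Y, Finset.mul_sum,
      Finset.sum_div]
    refine Finset.sum_le_sum fun i _ => ?_
    by_cases hi : NearIdentity ((K i * Y)ᴴ * (K i * Y))
    · rcases (re_trace_nonneg hi.posSemidef).eq_or_lt with hi0 | hi0
      · rw [← hi0, mul_zero, zero_div]
        exact cost_nonneg (posSemidef_pulledEffect ..) (posSemidef_pulledEffect ..)
      · exact ih i _ _ hX hi ha hi0
    · exact cost_ge_of_leave_right hX hY ha hb (Matrix.posSemidef_conjTranspose_mul_self _) hi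
        (posSemidef_pulledEffect ..) (posSemidef_pulledEffect ..)
        (posSemidef_pulledEffect ..) (posSemidef_pulledEffect ..)
        (pulledEffect_add ..) (pulledEffect_add ..) hc

lemma nearIdentity_one : NearIdentity 1 := by
  refine ⟨.one, ?_⟩
  norm_num [deviation, Matrix.trace_one]

lemma cost_effect_ge (P : LOCCProtocol 3 3) :
    1 / 4000000000 ≤ cost (P.effect true) (P.effect false) := by
  have near : NearIdentity ((1 : Matrix (Fin 3) (Fin 3) ℂ)ᴴ * 1) := by
    simpa using nearIdentity_one
  -- At the root both traces are `3`, and `9/32000000000` exceeds the stated constant.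
  have h := cost_pulledEffect_ge P 1 1 near near
  simp [pulledEffect, Matrix.trace_one] at h
  linarith

lemma success_add_cost {π : BipOp 3 3 × BipOp 3 3} (h : π.1 + π.2 = 1) :
    (π.1 * rhoState).trace.re + (π.2 * sigmaState).trace.re = 2 - cost π.1 π.2 := by
  have h1 := congrArg (fun M => (M * rhoState).trace.re) h
  have h2 := congrArg (fun M => (M * sigmaState).trace.re) h
  simp only [add_mul, one_mul, Matrix.trace_add, Complex.add_re, trace_rhoState,
    trace_sigmaState, Complex.one_re] at h1 h2
  rw [cost, Complex.add_re]
  linarith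

/-- The success probabilities of any LOCC measurement are bounded away from the perfect ones. -/
lemma success_le_of_mem_LOCC {π : BipOp 3 3 × BipOp 3 3} (hπ : π ∈ LOCC 3 3) :
    π.1 + π.2 = 1 ∧
      (π.1 * rhoState).trace.re + (π.2 * sigmaState).trace.re ≤ 2 - 1 / 4000000000 := by
  obtain ⟨P, rfl⟩ := hπ
  have h := P.effect_true_add_effect_false
  refine ⟨h, ?_⟩
  rw [success_add_cost h]
  linarith [cost_effect_ge P]

/-! ### The separable measurement and the distinguishability norms -/

lemma isSeparableOp_sum_ketbra {ι : Type} [Fintype ι] (φ χ : ι → Fin 3 → ℂ)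
    (hφ : ∀ i, star (φ i) ⬝ᵥ φ i = 1) (hχ : ∀ i, star (χ i) ⬝ᵥ χ i = 1) :
    IsSeparableOp (∑ i, ketbra (ketTensor (φ i) (χ i))) := by
  let e := Fintype.equivFin ι
  refine ⟨Fintype.card ι, fun _ => 1, fun j => φ (e.symm j), fun j => χ (e.symm j),
    fun _ => one_pos, fun j => hφ _, fun j => hχ _, ?_⟩
  simp only [Complex.ofReal_one, one_smul, ← ketbra_ketTensor]
  exact (e.symm.sum_comp fun i => ketbra (ketTensor (φ i) (χ i))).symm

lemma ket_dot_self (i : Fin 3) : star (ket i) ⬝ᵥ ket i = 1 := by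
  simpa using ket_form 1 i i

lemma ketPM_dot_self {s : ℂ} (hs : star s * s = 1) {i j : Fin 3} (hij : i ≠ j) :
    star (ketPM s i j) ⬝ᵥ ketPM s i j = 1 := by
  have h := ketPM_form 1 s s i j i j
  rw [Matrix.one_mulVec] at h
  rw [h]
  simp only [Matrix.one_apply_eq, Matrix.one_apply_ne hij, Matrix.one_apply_ne hij.symm, mul_zero,
    mul_one, zero_add, add_zero, hs]
  norm_num

lemma psi_eq (s : ℂ) : psi s = fun i =>
    ketTensor ((![ket 0, ketPM s 0 1, ketPM s 1 2, ket 2] : Fin 4 → Fin 3 → ℂ) i)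
      ((![ketPM s 0 1, ket 2, ket 0, ketPM s 1 2] : Fin 4 → Fin 3 → ℂ) i) := by
  ext i
  fin_cases i <;> rfl

lemma isSeparableOp_sigmaProj : IsSeparableOp sigmaProj := by
  rw [sigmaProj, psi_eq]
  refine isSeparableOp_sum_ketbra _ _ ?_ ?_ <;>
    simp [Fin.forall_fin_succ, ket_dot_self, ketPM_dot_self]

lemma isSeparableOp_rhoProj : IsSeparableOp rhoProj := by
  have h := isSeparableOp_sum_ketbra (ι := Option (Fin 4))
    (fun o => o.elim (ket 1) ![ket 0, ketPM (-1) 0 1, ketPM (-1) 1 2, ket 2])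
    (fun o => o.elim (ket 1) ![ketPM (-1) 0 1, ket 2, ket 0, ketPM (-1) 1 2])
  rw [Fintype.sum_option] at h
  rw [rhoProj, psi_eq]
  refine h ?_ ?_ <;>
    simp [Option.forall, Fin.forall_fin_succ, ket_dot_self, ketPM_dot_self]

lemma proj_mem_SEP : (rhoProj, sigmaProj) ∈ SEP 3 3 :=
  ⟨⟨posSemidef_rhoProj, posSemidef_sigmaProj, rhoProj_add_sigmaProj⟩, isSeparableOp_rhoProj,
    isSeparableOp_sigmaProj⟩

lemma proj_perfectlyDistinguishes :
    PerfectlyDistinguishes (rhoProj, sigmaProj) rhoState sigmaState := by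
  constructor
  · simp [rhoState_eq, rhoProj_mul_self, trace_rhoProj]
  · simp [sigmaState_eq, sigmaProj_mul_self, trace_sigmaProj]

/-- Uniqueness of the decomposition of a hermitian matrix into orthogonal positive parts. -/
lemma orthogonal_decomposition_unique {ι : Type} [Fintype ι] [DecidableEq ι]
    {R S R' S' : Matrix ι ι ℂ} (hR : R.PosSemidef) (hS : S.PosSemidef) (hR' : R'.PosSemidef)
    (hS' : S'.PosSemidef) (h : R * S = 0) (h' : R' * S' = 0) (e : R - S = R' - S') :
    R = R' ∧ S = S' := by
  have e' : R - R' = S - S' := by rw [sub_eq_sub_iff_add_eq_add] at e ⊢; rw [e, add_comm]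
  suffices h0 : R - R' = 0 from ⟨sub_eq_zero.mp h0, sub_eq_zero.mp (e' ▸ h0)⟩
  have herm : (R - R')ᴴ = R - R' := (hR.1.sub hR'.1).eq
  rw [← Matrix.trace_conjTranspose_mul_self_eq_zero_iff]
  have pos := Matrix.posSemidef_conjTranspose_mul_self (R - R')
  -- One factor `R - R'` is replaced by `S - S'`; the orthogonal products vanish, and the remaining
  -- cross terms make the squared Hilbert–Schmidt norm nonpositive.
  have t : ((R - R')ᴴ * (R - R')).trace.re = -(R * S').trace.re - (R' * S).trace.re := by
    rw [herm]
    nth_rewrite 2 [e']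
    rw [sub_mul, mul_sub, mul_sub, h, h']
    simp
  have n1 := re_trace_mul_nonneg hR hS'
  have n2 := re_trace_mul_nonneg hR' hS
  rw [trace_eq_ofReal pos, le_antisymm (by linarith) (re_trace_nonneg pos), Complex.ofReal_zero]

/-! ### Evaluation and separation of the two norms -/

lemma distNorm_state_eq (Ω : Set (BipOp 3 3 × BipOp 3 3)) :
    distNorm Ω (rhoState - sigmaState) =
      sSup ((fun π => (π.1 * rhoState).trace.re + (π.2 * sigmaState).trace.re) '' Ω) := by
  rw [distNorm]
  congr 1
  ext v
  constructor
  · rintro ⟨R, S, hR, hS, hRS, e, π, hπ, rfl⟩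
    obtain ⟨rfl, rfl⟩ := orthogonal_decomposition_unique hR hS posSemidef_rhoState
      posSemidef_sigmaState hRS rhoState_mul_sigmaState e.symm
    exact ⟨π, hπ, (Complex.add_re _ _).symm⟩
  · rintro ⟨π, hπ, rfl⟩
    exact ⟨rhoState, sigmaState, posSemidef_rhoState, posSemidef_sigmaState,
      rhoState_mul_sigmaState, rfl, π, hπ, (Complex.add_re _ _).symm⟩

lemma bias_eq {π : BipOp 3 3 × BipOp 3 3} (h : π.1 + π.2 = 1) :
    ((π.1 - π.2) * (rhoState - sigmaState)).trace.re =
      2 * ((π.1 * rhoState).trace.re + (π.2 * sigmaState).trace.re) - 2 := by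
  have h1 := success_add_cost h
  rw [cost, Complex.add_re] at h1
  simp only [sub_mul, mul_sub, Matrix.trace_sub, Complex.sub_re]
  linarith

lemma success_le_of_mem_SEP {π : BipOp 3 3 × BipOp 3 3} (hπ : π ∈ SEP 3 3) :
    (π.1 * rhoState).trace.re + (π.2 * sigmaState).trace.re ≤ 2 := by
  rw [success_add_cost hπ.1.2.2]
  linarith [cost_nonneg hπ.1.1 hπ.1.2.1]

lemma proj_success : (rhoProj * rhoState).trace.re + (sigmaProj * sigmaState).trace.re = 2 := by
  rw [proj_perfectlyDistinguishes.1, proj_perfectlyDistinguishes.2]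
  norm_num

lemma LOCC_nonempty : (LOCC 3 3).Nonempty := ⟨_, .guess true, rfl⟩

lemma not_perfectlyDistinguishes_of_mem_closure {π : BipOp 3 3 × BipOp 3 3}
    (hπ : π ∈ closure (LOCC 3 3)) : ¬ PerfectlyDistinguishes π rhoState sigmaState := by
  have closed : IsClosed {π : BipOp 3 3 × BipOp 3 3 |
      (π.1 * rhoState).trace.re + (π.2 * sigmaState).trace.re ≤ 2 - 1 / 4000000000} := by
    refine isClosed_le ?_ continuous_const
    fun_prop
  have h : (π.1 * rhoState).trace.re + (π.2 * sigmaState).trace.re ≤ 2 - 1 / 4000000000 :=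
    closure_minimal (fun π hπ => (success_le_of_mem_LOCC hπ).2) closed hπ
  rintro ⟨h1, h2⟩
  rw [h1, h2] at h
  norm_num at h

lemma distNorm_LOCC_lt_distNorm_SEP :
    distNorm (LOCC 3 3) (rhoState - sigmaState) < distNorm (SEP 3 3) (rhoState - sigmaState) := by
  rw [distNorm_state_eq, distNorm_state_eq]
  refine lt_of_le_of_lt (b := 2 - 1 / 4000000000) ?_ (lt_of_lt_of_le (b := 2) (by norm_num) ?_)
  · refine csSup_le (LOCC_nonempty.image _) ?_
    rintro _ ⟨π, hπ, rfl⟩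
    exact (success_le_of_mem_LOCC hπ).2
  -- The upper bound `2` is essential: an unbounded real set has `sSup` equal to `0`.
  · refine le_csSup ⟨2, ?_⟩ ⟨_, proj_mem_SEP, proj_success⟩
    rintro _ ⟨π, hπ, rfl⟩
    exact success_le_of_mem_SEP hπ

lemma distBiasNorm_LOCC_lt_distBiasNorm_SEP :
    distBiasNorm (LOCC 3 3) (rhoState - sigmaState) <
      distBiasNorm (SEP 3 3) (rhoState - sigmaState) := by
  have h1 : distBiasNorm (LOCC 3 3) (rhoState - sigmaState) ≤ 2 - 1 / 2000000000 := by
    obtain ⟨π₀, hπ₀⟩ := LOCC_nonempty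
    refine csSup_le ⟨_, π₀, hπ₀, rfl⟩ ?_
    · rintro v ⟨π, hπ, rfl⟩
      obtain ⟨h, hle⟩ := success_le_of_mem_LOCC hπ
      rw [bias_eq h]
      linarith
  have h2 : 2 ≤ distBiasNorm (SEP 3 3) (rhoState - sigmaState) := by
    refine le_csSup ⟨2, ?_⟩ ⟨_, proj_mem_SEP, ?_⟩
    · rintro v ⟨π, hπ, rfl⟩
      rw [bias_eq hπ.1.2.2]
      linarith [success_le_of_mem_SEP hπ]
    · rw [bias_eq rhoProj_add_sigmaProj, proj_success]
      norm_num
  linarith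

theorem mainTheorem2 :
    (∃ π ∈ SEP 3 3, PerfectlyDistinguishes π rhoState sigmaState) ∧
    (∀ π ∈ closure (LOCC 3 3), ¬ PerfectlyDistinguishes π rhoState sigmaState) ∧
    distNorm (LOCC 3 3) (rhoState - sigmaState) < distNorm (SEP 3 3) (rhoState - sigmaState) ∧
    distBiasNorm (LOCC 3 3) (rhoState - sigmaState)
      < distBiasNorm (SEP 3 3) (rhoState - sigmaState) :=
  ⟨⟨_, proj_mem_SEP, proj_perfectlyDistinguishes⟩,
    fun _ hπ => not_perfectlyDistinguishes_of_mem_closure hπ,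
    distNorm_LOCC_lt_distNorm_SEP, distBiasNorm_LOCC_lt_distBiasNorm_SEP⟩
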